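/- Let $n,m\ge 0$ be integers. An embedded simplicial complex $K$ in $\mathbb{R}^n$ is a finite collection of simplices (convex hulls of nonempty finite affinely independent sets of points of $\mathbb{R}^n$) such that every nonempty face of a simplex of the collection belongs to the collection, and such that the intersection of two of its simplices, if nonempty, is a face of both; we also write $K\subseteq\mathbb{R}^n$ for the union of its simplices. For $v$ in the unit sphere $S^{n-1}\subseteq\mathbb{R}^n$ and $r\in\mathbb{R}$ put $K_{v,r}=\{x\in K : x\cdot v\le r\}$, and let $\mathcal{F}_K(v):\mathbb{R}\to\mathbb{R}$, $r\mapsto\chi(K_{v,r})$, be the Euler curve. Here $\chi(S)=\sum_{d=0}^n(-1)^dk_d$ is the Euler characteristic of a semialgebraic set $S\subseteq\mathbb{R}^n$, where $k_d$ is the number of $d$-dimensional cells in any finite partition of $S$ into semialgebraic cells (this does not depend on the partition). Let $\mathcal{D}_1,\dots,\mathcal{D}_m:\operatorname{Map}(\mathbb{R}\to\mathbb{R})\to\mathbb{R}$ be translation-invariant functionals, i.e. if $f,g:\mathbb{R}\to\mathbb{R}$ and there is $t\in\mathbb{R}$ with $f(x)=g(x+t)$ for all $x$, then $\mathcal{D}_if=\mathcal{D}_ig$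 for all $i$. Define $$\mathcal{DF}_K:S^{n-1}\to\mathbb{R}^m,\qquad v\mapsto\big(\mathcal{D}_1(\mathcal{F}_K(v)),\dots,\mathcal{D}_m(\mathcal{F}_K(v))\big).$$ Then: 1. ($\mathrm{O}(n)$-equivariance) for every embedded simplicial complex $K$ in $\mathbb{R}^n$ and every $R\in\mathrm{O}(n)$, with $RK=\{R^{-1}x : x\in K\}$, one has $\mathcal{DF}_{RK}(v)=\mathcal{DF}_K(Rv)$ for all $v\in S^{n-1}$; 2. (translation invariance) for every embedded simplicial complex $K$ in $\mathbb{R}^n$ and every $w\in\mathbb{R}^n$, with $K+w=\{x+w : x\in K\}$, one has $\mathcal{DF}_{K+w}=\mathcal{DF}_K$; 3. (subdivision invariance) if $K$ and $K'$ are embedded simplicial complexes in $\mathbb{R}^n$ and $K'$ is a subdivision of $K$ (each simplex of $K'$ is contained in a simplex of $K$, and each simplex of $K$ is a finite union of simplices of $K'$), then $\mathcal{DF}_{K'}=\mathcal{DF}_K$. -/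

import Mathlib

open Set Filter Topology

namespace EulerCurve

/-! ### Semialgebraic sets, cells and the Euler characteristic -/

/-- Semialgebraic subsets of `ℝⁿ`: the sets obtained from sets `{f > 0}` and `{g = 0}`, with `f`, `g`
real polynomials in `n` variables, by finitely many unions and intersections. -/
inductive IsSemialgebraic {n : ℕ} : Set (Fin n → ℝ) → Prop
  | pos (p : MvPolynomial (Fin n) ℝ) : IsSemialgebraic {x | 0 < MvPolynomial.eval x p}
  | zero (p : MvPolynomial (Fin n) ℝ) : IsSemialgebraic {x | MvPolynomial.eval x p = 0}
  | union {S T : Set (Fin n → ℝ)} :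
      IsSemialgebraic S → IsSemialgebraic T → IsSemialgebraic (S ∪ T)
  | inter {S T : Set (Fin n → ℝ)} :
      IsSemialgebraic S → IsSemialgebraic T → IsSemialgebraic (S ∩ T)

/-- The graph over `B ⊆ ℝⁿ` of a function `f`, as a subset of `ℝⁿ⁺¹`. -/
def graphOver {n : ℕ} (B : Set (Fin n → ℝ)) (f : (Fin n → ℝ) → ℝ) : Set (Fin (n + 1) → ℝ) :=
  {x | Fin.init x ∈ B ∧ x (Fin.last n) = f (Fin.init x)}

/-- `f` restricts to a continuous semialgebraic function on `B` (its graph is semialgebraic). -/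
def IsContSemialg {n : ℕ} (B : Set (Fin n → ℝ)) (f : (Fin n → ℝ) → ℝ) : Prop :=
  ContinuousOn f B ∧ IsSemialgebraic (graphOver B f)

/-- `IsCell n d C`: the set `C ⊆ ℝⁿ` is a (semialgebraic) cell of dimension `d`, in the usual sense
of o-minimal geometry. The one-point space `ℝ⁰` is a cell of dimension `0`. The cells of `ℝⁿ⁺¹` are,
over a cell `B` of `ℝⁿ` of dimension `d`, the graphs of continuous semialgebraic functions on `B`
(dimension `d`), and the bands strictly between two continuous semialgebraic functions `f < g` on
`B`, where `f` may also be the constant `-∞` and `g` the constant `+∞` (dimension `d + 1`). -/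
inductive IsCell : (n d : ℕ) → Set (Fin n → ℝ) → Prop
  | point : IsCell 0 0 univ
  | graph {n d : ℕ} {B : Set (Fin n → ℝ)} {f : (Fin n → ℝ) → ℝ} :
      IsCell n d B → IsContSemialg B f → IsCell (n + 1) d (graphOver B f)
  | band {n d : ℕ} {B : Set (Fin n → ℝ)} {f g : (Fin n → ℝ) → ℝ} :
      IsCell n d B → IsContSemialg B f → IsContSemialg B g → (∀ y ∈ B, f y < g y) →
      IsCell (n + 1) (d + 1)
        {x | Fin.init x ∈ B ∧ f (Fin.init x) < x (Fin.last n) ∧ x (Fin.last n) < g (Fin.init x)}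
  | bandAbove {n d : ℕ} {B : Set (Fin n → ℝ)} {f : (Fin n → ℝ) → ℝ} :
      IsCell n d B → IsContSemialg B f →
      IsCell (n + 1) (d + 1) {x | Fin.init x ∈ B ∧ f (Fin.init x) < x (Fin.last n)}
  | bandBelow {n d : ℕ} {B : Set (Fin n → ℝ)} {g : (Fin n → ℝ) → ℝ} :
      IsCell n d B → IsContSemialg B g →
      IsCell (n + 1) (d + 1) {x | Fin.init x ∈ B ∧ x (Fin.last n) < g (Fin.init x)}
  | cylinder {n d : ℕ} {B : Set (Fin n → ℝ)} :
      IsCell n d B → IsCell (n + 1) (d + 1) {x | Fin.init x ∈ B}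

/-- A finite partition of `S ⊆ ℝⁿ` into cells. -/
structure CellPartition {n : ℕ} (S : Set (Fin n → ℝ)) where
  /-- the number of cells -/
  card : ℕ
  /-- the cells -/
  cell : Fin card → Set (Fin n → ℝ)
  /-- the dimensions of the cells -/
  dim : Fin card → ℕ
  isCell : ∀ i, IsCell n (dim i) (cell i)
  disjoint : ∀ i j, i ≠ j → Disjoint (cell i) (cell j)
  iUnion_cell : ⋃ i, cell i = S

/-- The number `k_d` of `d`-dimensional cells of the partition. -/
def CellPartition.count {n : ℕ} {S : Set (Fin n → ℝ)} (P : CellPartition S) (d : ℕ) : ℕ :=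
  (Finset.univ.filter fun i => P.dim i = d).card

/-- The alternating sum `k_0 - k_1 + ⋯ + (-1)ⁿ k_n` for the partition. -/
def CellPartition.euler {n : ℕ} {S : Set (Fin n → ℝ)} (P : CellPartition S) : ℤ :=
  ∑ d ∈ Finset.range (n + 1), (-1) ^ d * (P.count d : ℤ)

open Classical in
/-- The Euler characteristic of a set `S ⊆ ℝⁿ` that has a finite partition into cells (every
semialgebraic set has one): the alternating sum `k_0 - k_1 + ⋯ + (-1)ⁿ k_n` for any such partition.
It does not depend on the partition, see `eulerChar_eq` below. (Sets that have no finite partition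
into cells get the value `0`.) -/
noncomputable def eulerChar {n : ℕ} (S : Set (Fin n → ℝ)) : ℤ :=
  if h : Nonempty (CellPartition S) then h.some.euler else 0

/-! ### Independence of the partition -/

/-- Auxiliary: the one-variable Euler integral of the indicator function of `J ⊆ ℝ` is `ε`. -/
def HasSign (J : Set ℝ) (ε : ℤ) : Prop :=
  ∃ (b : ℤ) (r : ℝ → ℤ) (P₀ : Finset ℝ),
    (∀ x, ∀ᶠ t in 𝓝[>] x, J.indicator 1 t = r x) ∧ (∀ᶠ t in atBot, J.indicator 1 t = b) ∧
      ∀ P : Finset ℝ, P₀ ⊆ P → ∑ x ∈ P, (J.indicator 1 x - r x) - b = ε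

theorem HasSign.sum_eq_zero {ι : Type} [Fintype ι] {a ε : ι → ℤ} {J : ι → Set ℝ}
    (hJ : ∀ i, HasSign (J i) (ε i)) (h : ∀ t, ∑ i, a i * (J i).indicator 1 t = 0) :
    ∑ i, a i * ε i = 0 := by
  classical
  choose b r P₀ hr hb hP using hJ
  have hr' : ∀ x, ∑ i, a i * r i x = 0 := fun x => by
    obtain ⟨t, ht⟩ := (eventually_all.2 fun i => hr i x).exists
    simpa [ht] using h t
  have hb' : ∑ i, a i * b i = 0 := by
    obtain ⟨t, ht⟩ := (eventually_all.2 hb).exists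
    simpa [ht] using h t
  have hε : ∀ i, ε i = ∑ x ∈ Finset.univ.biUnion P₀, ((J i).indicator 1 x - r i x) - b i :=
    fun i => (hP i _ (Finset.subset_biUnion_of_mem P₀ (Finset.mem_univ i))).symm
  simp only [hε, mul_sub, Finset.sum_sub_distrib, Finset.mul_sum, hb', sub_zero]
  rw [Finset.sum_comm, Finset.sum_comm (f := fun i x => a i * r i x)]
  simp [h, hr']

theorem hasSign_empty : HasSign ∅ 0 := ⟨0, 0, ∅, by simp, by simp, by simp⟩

theorem hasSign_univ : HasSign univ (-1) := ⟨1, 1, ∅, by simp, by simp, by simp⟩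

theorem hasSign_Iio (c : ℝ) : HasSign (Iio c) (-1) := by
  refine ⟨1, (Iio c).indicator 1, ∅, fun x => ?_, ?_, by simp⟩
  · rcases lt_or_ge x c with h | h
    · filter_upwards [Ioo_mem_nhdsGT h] with t ht
      simp [indicator, h, ht.2]
    · filter_upwards [self_mem_nhdsWithin] with t ht
      have : c < t := lt_of_le_of_lt h ht
      simp [indicator, h.not_gt, this.not_gt]
  · filter_upwards [Iio_mem_atBot c] with t ht
    simp [indicator, ht]

theorem hasSign_singleton (c : ℝ) : HasSign {c} 1 := by
  refine ⟨0, 0, {c}, fun x => ?_, ?_, fun P hP => ?_⟩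
  · rcases lt_or_ge x c with h | h
    · filter_upwards [Ioo_mem_nhdsGT h] with t ht
      simp [indicator, ht.2.ne]
    · filter_upwards [self_mem_nhdsWithin] with t ht
      have : c < t := lt_of_le_of_lt h ht
      simp [indicator, this.ne']
  · filter_upwards [Iio_mem_atBot c] with t ht
    simp [indicator, (mem_Iio.1 ht).ne]
  · simp only [Finset.singleton_subset_iff] at hP
    simp [indicator, hP]

theorem hasSign_Ioi (c : ℝ) : HasSign (Ioi c) (-1) := by
  refine ⟨0, (Ici c).indicator 1, {c}, fun x => ?_, ?_, fun P hP => ?_⟩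
  · rcases lt_or_ge x c with h | h
    · filter_upwards [Ioo_mem_nhdsGT h] with t ht
      simp [indicator, h.not_ge, ht.2.le]
    · filter_upwards [self_mem_nhdsWithin] with t ht
      have : c < t := lt_of_le_of_lt h ht
      simp [indicator, h, this]
  · filter_upwards [Iio_mem_atBot c] with t ht
    simp [indicator, (mem_Iio.1 ht).le]
  · simp only [Finset.singleton_subset_iff] at hP
    have : ∀ x, (Ioi c).indicator (1 : ℝ → ℤ) x - (Ici c).indicator 1 x =
        if x = c then -1 else 0 := fun x => by
      rcases lt_trichotomy x c with h | h | h
      · simp [indicator, h.le, h.not_ge, h.ne]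
      · simp [indicator, h]
      · simp [indicator, h, h.le, h.ne']
    simp [this, hP]

theorem hasSign_Ioo {c e : ℝ} (hce : c < e) : HasSign (Ioo c e) (-1) := by
  refine ⟨0, (Ico c e).indicator 1, {c}, fun x => ?_, ?_, fun P hP => ?_⟩
  · rcases lt_or_ge x c with h | h
    · filter_upwards [Ioo_mem_nhdsGT h] with t ht
      simp [indicator, h.not_ge, ht.2.not_gt]
    · rcases lt_or_ge x e with h' | h'
      · filter_upwards [Ioo_mem_nhdsGT h'] with t ht
        simp [indicator, h, h', ht.2, h.trans_lt ht.1]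
      · filter_upwards [self_mem_nhdsWithin] with t ht
        have : e < t := lt_of_le_of_lt h' ht
        simp [indicator, h'.not_gt, this.not_gt]
  · filter_upwards [Iio_mem_atBot c] with t ht
    simp [indicator, (mem_Iio.1 ht).not_gt]
  · simp only [Finset.singleton_subset_iff] at hP
    have : ∀ x, (Ioo c e).indicator (1 : ℝ → ℤ) x - (Ico c e).indicator 1 x =
        if x = c then -1 else 0 := fun x => by
      rcases lt_trichotomy x c with h | h | h
      · simp [indicator, h.not_gt, h.not_ge, h.ne]
      · simp [indicator, h, hce]
      · simp [indicator, h, h.le, h.ne']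
    simp [this, hP]

theorem IsCell.exists_base {n d : ℕ} {C : Set (Fin (n + 1) → ℝ)} (hC : IsCell (n + 1) d C) :
    ∃ (B : Set (Fin n → ℝ)) (d' : ℕ) (ε : ℤ), IsCell n d' B ∧ (-1) ^ d = ε * (-1) ^ d' ∧
      ∀ y, HasSign {t | (Fin.snoc y t : Fin (n + 1) → ℝ) ∈ C} (ε * B.indicator 1 y) := by
  have key : ∀ (B : Set (Fin n → ℝ)) (ε : ℤ) (J : (Fin n → ℝ) → Set ℝ),
      (∀ y ∈ B, HasSign (J y) ε) → ∀ y, HasSign {t | y ∈ B ∧ t ∈ J y} (ε * B.indicator 1 y) := by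
    intro B ε J h y
    by_cases hy : y ∈ B
    · simpa [hy] using h y hy
    · simpa [hy] using hasSign_empty
  cases hC with
  | @graph _ _ B f hB hf =>
    refine ⟨B, d, 1, hB, by simp, fun y => ?_⟩
    simpa [graphOver] using key B 1 (fun y => {f y}) (fun y _ => hasSign_singleton _) y
  | @band _ d B f g hB hf hg hfg =>
    refine ⟨B, d, -1, hB, by ring, fun y => ?_⟩
    simpa using key B (-1) (fun y => Ioo (f y) (g y)) (fun y hy => hasSign_Ioo (hfg y hy)) y
  | @bandAbove _ d B f hB hf =>
    refine ⟨B, d, -1, hB, by ring, fun y => ?_⟩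
    simpa using key B (-1) (fun y => Ioi (f y)) (fun y _ => hasSign_Ioi _) y
  | @bandBelow _ d B g hB hg =>
    refine ⟨B, d, -1, hB, by ring, fun y => ?_⟩
    simpa using key B (-1) (fun y => Iio (g y)) (fun y _ => hasSign_Iio _) y
  | @cylinder _ d B hB =>
    refine ⟨B, d, -1, hB, by ring, fun y => ?_⟩
    simpa using key B (-1) (fun _ => univ) (fun y _ => hasSign_univ) y

theorem IsCell.sum_eq_zero {n : ℕ} : ∀ {ι : Type} [Fintype ι] {a : ι → ℤ} {d : ι → ℕ}
    {C : ι → Set (Fin n → ℝ)}, (∀ i, IsCell n (d i) (C i)) →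
    (∀ x, ∑ i, a i * (C i).indicator 1 x = 0) → ∑ i, a i * (-1) ^ d i = 0 := by
  induction n with
  | zero =>
    intro ι _ a d C hC h
    have hC' : ∀ i, d i = 0 ∧ C i = univ := fun i => by
      have := hC i
      generalize d i = e at this
      generalize C i = D at this
      cases this
      exact ⟨rfl, rfl⟩
    have := h 0
    simpa [fun i => (hC' i).1, fun i => (hC' i).2] using this
  | succ n ih =>
    intro ι _ a d C hC h
    choose B d' ε hB hd hs using fun i => (hC i).exists_base
    have := ih (a := fun i => a i * ε i) hB fun y => by
      have := HasSign.sum_eq_zero (a := a) (fun i => hs i y) fun t => by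
        simpa [indicator] using h (Fin.snoc y t : Fin (n + 1) → ℝ)
      simpa [mul_assoc] using this
    simpa [hd, mul_assoc] using this

theorem IsCell.dim_le {n d : ℕ} {C : Set (Fin n → ℝ)} (hC : IsCell n d C) : d ≤ n := by
  induction hC <;> omega

theorem CellPartition.euler_eq_sum {n : ℕ} {S : Set (Fin n → ℝ)} (P : CellPartition S) :
    P.euler = ∑ i, (-1) ^ P.dim i := by
  unfold CellPartition.euler CellPartition.count
  rw [← Finset.sum_fiberwise_of_maps_to (s := Finset.univ) (t := Finset.range (n + 1))
    (g := P.dim) (fun i _ => Finset.mem_range_succ_iff.2 (P.isCell i).dim_le)]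
  refine Finset.sum_congr rfl fun d _ => ?_
  rw [Finset.sum_congr rfl (g := fun _ => (-1 : ℤ) ^ d)]
  · simp [mul_comm]
  · intro i hi
    rw [(Finset.mem_filter.1 hi).2]

theorem CellPartition.sum_indicator {n : ℕ} {S : Set (Fin n → ℝ)} (P : CellPartition S)
    (x : Fin n → ℝ) : ∑ i, (P.cell i).indicator (1 : (Fin n → ℝ) → ℤ) x = S.indicator 1 x := by
  classical
  by_cases hx : x ∈ S
  · obtain ⟨i, hi⟩ : ∃ i, x ∈ P.cell i := by
      rw [← P.iUnion_cell] at hx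
      exact mem_iUnion.1 hx
    rw [Finset.sum_eq_single i]
    · simp [hi, hx]
    · intro j _ hj
      exact indicator_of_notMem (fun h => (P.disjoint j i hj).le_bot ⟨h, hi⟩) _
    · simp
  · rw [indicator_of_notMem hx]
    refine Finset.sum_eq_zero fun i _ => indicator_of_notMem (fun h => hx ?_) _
    rw [← P.iUnion_cell]
    exact mem_iUnion.2 ⟨i, h⟩

theorem CellPartition.euler_eq_euler {n : ℕ} {S : Set (Fin n → ℝ)} (P Q : CellPartition S) :
    P.euler = Q.euler := by
  have := IsCell.sum_eq_zero (ι := Fin P.card ⊕ Fin Q.card)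
    (a := Sum.elim (fun _ => 1) (fun _ => -1)) (d := Sum.elim P.dim Q.dim)
    (C := Sum.elim P.cell Q.cell) (by rintro (i | i); exacts [P.isCell i, Q.isCell i])
    (fun x => by simp [P.sum_indicator, Q.sum_indicator])
  simp only [Fintype.sum_sum_type, Sum.elim_inl, Sum.elim_inr, one_mul, neg_mul,
    Finset.sum_neg_distrib] at this
  rw [P.euler_eq_sum, Q.euler_eq_sum]
  linarith

/-- The Euler characteristic can be computed from any finite partition into cells. -/
theorem eulerChar_eq {n : ℕ} {S : Set (Fin n → ℝ)} (P : CellPartition S) :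
    eulerChar S = P.euler := by
  unfold eulerChar
  rw [dif_pos ⟨P⟩]
  exact CellPartition.euler_eq_euler _ _

/-! ### Embedded simplicial complexes -/

/-- An embedded simplicial complex in `ℝⁿ`: a finite collection of simplices in `ℝⁿ` that is closed
under passing to faces and in which two simplices that meet intersect in a common face. A simplex is
given by the finite set of its (affinely independent) vertices. The subset of `ℝⁿ` that the complex
describes, the union of its simplices, is `K.space`. -/
structure EmbeddedComplex (n : ℕ) extends
    Geometry.SimplicialComplex ℝ (EuclideanSpace ℝ (Fin n)) where
  finite_faces : faces.Finite

namespace EmbeddedComplex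

variable {n : ℕ}

/-- The union of the simplices of `K`. -/
abbrev space (K : EmbeddedComplex n) : Set (EuclideanSpace ℝ (Fin n)) :=
  K.toSimplicialComplex.space

/-- The image of an embedded simplicial complex under an affine automorphism of `ℝⁿ`. -/
def map (K : EmbeddedComplex n)
    (e : EuclideanSpace ℝ (Fin n) ≃ᵃ[ℝ] EuclideanSpace ℝ (Fin n)) : EmbeddedComplex n where
  faces := (fun s => s.map e.toEquiv.toEmbedding) '' K.faces
  isRelLowerSet_faces := by
    rintro _ ⟨s, hs, rfl⟩
    refine ⟨by simpa using K.nonempty_of_mem_faces hs, fun t ht ht' => ?_⟩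
    obtain ⟨u, hu, rfl⟩ := Finset.subset_map_iff.1 ht
    exact ⟨u, K.down_closed hs hu (by simpa using ht'), rfl⟩
  indep := by
    rintro _ ⟨s, hs, rfl⟩
    have := e.affineIndependent_set_of_eq_iff.2 (K.indep hs)
    have h : ((s.map e.toEquiv.toEmbedding : Finset _) : Set (EuclideanSpace ℝ (Fin n))) =
        e '' (s : Set (EuclideanSpace ℝ (Fin n))) := by simp
    rw [← h] at this
    exact this
  inter_subset_convexHull := by
    rintro _ _ ⟨s, hs, rfl⟩ ⟨t, ht, rfl⟩
    have h : ∀ s : Finset (EuclideanSpace ℝ (Fin n)),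
        ((s.map e.toEquiv.toEmbedding : Finset _) : Set (EuclideanSpace ℝ (Fin n))) =
        (e : _ →ᵃ[ℝ] _) '' (s : Set (EuclideanSpace ℝ (Fin n))) := by simp
    have he : Function.Injective (e : EuclideanSpace ℝ (Fin n) →ᵃ[ℝ] EuclideanSpace ℝ (Fin n)) :=
      e.injective
    rw [h, h, ← image_inter he, ← AffineMap.image_convexHull, ← AffineMap.image_convexHull,
      ← AffineMap.image_convexHull, ← image_inter he]
    exact image_mono (K.inter_subset_convexHull hs ht)
  finite_faces := K.finite_faces.image _

theorem space_map (K : EmbeddedComplex n)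
    (e : EuclideanSpace ℝ (Fin n) ≃ᵃ[ℝ] EuclideanSpace ℝ (Fin n)) :
    (K.map e).space = e '' K.space := by
  have h : ∀ s : Finset (EuclideanSpace ℝ (Fin n)),
      ((s.map e.toEquiv.toEmbedding : Finset _) : Set (EuclideanSpace ℝ (Fin n))) =
      (e : _ →ᵃ[ℝ] _) '' (s : Set (EuclideanSpace ℝ (Fin n))) := by simp
  simp only [space, Geometry.SimplicialComplex.space, map, biUnion_image, image_iUnion₂, h,
    ← AffineMap.image_convexHull]
  rfl

/-- `K'` is a subdivision of `K`: each simplex of `K'` is contained in a simplex of `K`, and each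
simplex of `K` is a finite union of simplices of `K'`. -/
def IsSubdivision (K' K : EmbeddedComplex n) : Prop :=
  (∀ s ∈ K'.faces, ∃ t ∈ K.faces,
    convexHull ℝ (s : Set (EuclideanSpace ℝ (Fin n))) ⊆ convexHull ℝ (t : Set _)) ∧
  ∀ t ∈ K.faces, ∃ F : Set (Finset (EuclideanSpace ℝ (Fin n))), F.Finite ∧ F ⊆ K'.faces ∧
    convexHull ℝ (t : Set (EuclideanSpace ℝ (Fin n))) = ⋃ s ∈ F, convexHull ℝ (s : Set _)

end EmbeddedComplex

/-- The linear isometry `x ↦ R x` of `ℝⁿ` given by an orthogonal matrix `R ∈ O(n)`. -/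
noncomputable def orthogonalMap {n : ℕ} (R : Matrix.orthogonalGroup (Fin n) ℝ) :
    EuclideanSpace ℝ (Fin n) ≃ₗᵢ[ℝ] EuclideanSpace ℝ (Fin n) :=
  Unitary.linearIsometryEquiv
    ⟨Matrix.toEuclideanCLM (n := Fin n) (𝕜 := ℝ) R.1, Unitary.map_mem _ R.2⟩

theorem orthogonalMap_apply {n : ℕ} (R : Matrix.orthogonalGroup (Fin n) ℝ)
    (x : EuclideanSpace ℝ (Fin n)) :
    orthogonalMap R x = WithLp.toLp 2 (R.1.mulVec (WithLp.ofLp x)) := rfl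

/-- `RK = {R⁻¹ x | x ∈ K}` for `R ∈ O(n)`. -/
noncomputable def EmbeddedComplex.rotate {n : ℕ} (R : Matrix.orthogonalGroup (Fin n) ℝ)
    (K : EmbeddedComplex n) : EmbeddedComplex n :=
  K.map (orthogonalMap R⁻¹).toLinearEquiv.toAffineEquiv

/-- `K + w = {x + w | x ∈ K}` for `w ∈ ℝⁿ`. -/
noncomputable def EmbeddedComplex.translate {n : ℕ} (K : EmbeddedComplex n)
    (w : EuclideanSpace ℝ (Fin n)) : EmbeddedComplex n :=
  K.map (AffineEquiv.constVAdd ℝ (EuclideanSpace ℝ (Fin n)) w)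

theorem EmbeddedComplex.space_rotate {n : ℕ} (R : Matrix.orthogonalGroup (Fin n) ℝ)
    (K : EmbeddedComplex n) :
    (K.rotate R).space = (fun x => orthogonalMap R⁻¹ x) '' K.space := by
  refine (K.space_map _).trans (image_congr fun x _ => ?_)
  rfl

theorem EmbeddedComplex.space_translate {n : ℕ} (K : EmbeddedComplex n)
    (w : EuclideanSpace ℝ (Fin n)) : (K.translate w).space = (fun x => x + w) '' K.space := by
  refine (K.space_map _).trans (image_congr fun x _ => ?_)
  exact add_comm w x

/-! ### The Euler curve transform -/

/-- The unit sphere `Sⁿ⁻¹` of `ℝⁿ`. -/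
abbrev UnitSphere (n : ℕ) : Type := Metric.sphere (0 : EuclideanSpace ℝ (Fin n)) 1

/-- The filtration `K_{v,r} = {x ∈ ℝⁿ | x ⬝ v ≤ r} ∩ K`. -/
def EmbeddedComplex.sublevel {n : ℕ} (K : EmbeddedComplex n) (v : UnitSphere n) (r : ℝ) :
    Set (EuclideanSpace ℝ (Fin n)) :=
  {x | inner ℝ x (v : EuclideanSpace ℝ (Fin n)) ≤ r} ∩ K.space

/-- The Euler curve `𝓕_K(v) : r ↦ χ(K_{v,r})`. -/
noncomputable def EmbeddedComplex.eulerCurve {n : ℕ} (K : EmbeddedComplex n) (v : UnitSphere n) :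
    ℝ → ℝ :=
  fun r => (eulerChar {x : Fin n → ℝ | WithLp.toLp 2 x ∈ K.sublevel v r} : ℝ)

/-- The map `𝓓𝓕_K : Sⁿ⁻¹ → ℝᵐ`, `v ↦ (𝓓_i(𝓕_K(v)))_i`. -/
noncomputable def EmbeddedComplex.curveFeatures {n m : ℕ} (D : Fin m → (ℝ → ℝ) → ℝ)
    (K : EmbeddedComplex n) : UnitSphere n → (Fin m → ℝ) :=
  fun v i => D i (K.eulerCurve v)

/-- A functional `𝓓` on `Map(ℝ → ℝ)` is translation-invariant. -/
def IsTranslationInvariant (D : (ℝ → ℝ) → ℝ) : Prop :=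
  ∀ f g : ℝ → ℝ, (∃ t : ℝ, ∀ x, f x = g (x + t)) → D f = D g

/-- For `f` defined on `Sⁿ⁻¹` and `R ∈ O(n)`, the function `Rf : v ↦ f(Rv)`. -/
noncomputable def rotateFun {n : ℕ} {α : Type*} (R : Matrix.orthogonalGroup (Fin n) ℝ)
    (f : UnitSphere n → α) : UnitSphere n → α :=
  fun v => f ⟨orthogonalMap R v, by simp⟩

end EulerCurve

namespace EulerCurve

/-! ### Semialgebraicity of sets defined by affine functions -/

/-! The difficulty is that cells depend on the order of the coordinates: a rotation does not send
cells to cells, so rotation invariance of `eulerChar` is not formal. It is proved for finite unions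
of compact convex polytopes, which suffices because a sublevel set $K_{v,r}$ is the union of the
simplices of $K$ cut by a half-space.

Inclusion-exclusion (`eulerChar_iUnion_eq_sum`) expresses the Euler characteristic of such a union
through those of the intersections of its members. Each intersection is a polytope, and its Euler
characteristic is 1 if it is nonempty and 0 otherwise (`IsPolytope.eulerChar_eq_one`). Affine
bijections preserve emptiness, so they preserve the Euler characteristic of the union
(`eulerChar_preimage_iUnion`).

The value 1 comes from projecting along the last coordinate: the nonempty fibres are compact
intervals, of Euler characteristic 1, so the projection keeps the Euler characteristic and the
dimension drops to 0. All of this requires that the sets involved have cell partitions. They are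
semilinear, hence finite disjoint unions of relatively open polyhedra, and these are cells by
Fourier–Motzkin elimination.

The theorem follows: rotating $K$ rotates the direction, translating $K$ by $w$ shifts the curve by
$w\cdot v$, and subdividing leaves the union of simplices unchanged. -/

theorem isSemialgebraic_univ {n : ℕ} : IsSemialgebraic (univ : Set (Fin n → ℝ)) := by
  simpa using IsSemialgebraic.zero (0 : MvPolynomial (Fin n) ℝ)

theorem isSemialgebraic_empty {n : ℕ} : IsSemialgebraic (∅ : Set (Fin n → ℝ)) := by
  simpa using IsSemialgebraic.pos (0 : MvPolynomial (Fin n) ℝ)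

theorem IsSemialgebraic.biInter {n : ℕ} {ι : Type*} (s : Finset ι) {S : ι → Set (Fin n → ℝ)}
    (h : ∀ i ∈ s, IsSemialgebraic (S i)) : IsSemialgebraic (⋂ i ∈ s, S i) := by
  classical
  induction s using Finset.induction_on with
  | empty => simpa using isSemialgebraic_univ
  | insert a s _ ih =>
    rw [Finset.set_biInter_insert]
    exact (h a (by simp)).inter (ih fun i hi => h i (by simp [hi]))

theorem IsSemialgebraic.biUnion {n : ℕ} {ι : Type*} (s : Finset ι) {S : ι → Set (Fin n → ℝ)}
    (h : ∀ i ∈ s, IsSemialgebraic (S i)) : IsSemialgebraic (⋃ i ∈ s, S i) := by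
  classical
  induction s using Finset.induction_on with
  | empty => simpa using isSemialgebraic_empty
  | insert a s _ ih =>
    rw [Finset.set_biUnion_insert]
    exact (h a (by simp)).union (ih fun i hi => h i (by simp [hi]))

theorem IsSemialgebraic.preimage_init {n : ℕ} {B : Set (Fin n → ℝ)} (hB : IsSemialgebraic B) :
    IsSemialgebraic {x : Fin (n + 1) → ℝ | Fin.init x ∈ B} := by
  induction hB with
  | pos p =>
    have := IsSemialgebraic.pos (MvPolynomial.rename Fin.castSucc p)
    simp only [MvPolynomial.eval_rename] at this
    exact this
  | zero p =>
    have := IsSemialgebraic.zero (MvPolynomial.rename Fin.castSucc p)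
    simp only [MvPolynomial.eval_rename] at this
    exact this
  | union _ _ h₁ h₂ => exact h₁.union h₂
  | inter _ _ h₁ h₂ => exact h₁.inter h₂

theorem exists_eval_eq_affine {n : ℕ} (f : (Fin n → ℝ) →ᵃ[ℝ] ℝ) :
    ∃ p : MvPolynomial (Fin n) ℝ, ∀ x, MvPolynomial.eval x p = f x := by
  refine ⟨∑ i, MvPolynomial.X i * MvPolynomial.C (f.linear (Pi.single i 1)) +
    MvPolynomial.C (f 0), fun x => ?_⟩
  have h : f x = f.linear x + f 0 := by simpa using f.map_vadd 0 x
  rw [h, LinearMap.pi_apply_eq_sum_univ f.linear x]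
  have h' : ∀ i : Fin n, (Pi.single i 1 : Fin n → ℝ) = fun j => if i = j then 1 else 0 := by
    intro i
    ext j
    simp [Pi.single_apply, eq_comm]
  simp [h']

theorem isSemialgebraic_affine_pos {n : ℕ} (f : (Fin n → ℝ) →ᵃ[ℝ] ℝ) :
    IsSemialgebraic {x | 0 < f x} := by
  obtain ⟨p, hp⟩ := exists_eval_eq_affine f
  simpa only [hp] using IsSemialgebraic.pos p

theorem isSemialgebraic_affine_zero {n : ℕ} (f : (Fin n → ℝ) →ᵃ[ℝ] ℝ) :
    IsSemialgebraic {x | f x = 0} := by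
  obtain ⟨p, hp⟩ := exists_eval_eq_affine f
  simpa only [hp] using IsSemialgebraic.zero p

theorem isSemialgebraic_affine_nonneg {n : ℕ} (f : (Fin n → ℝ) →ᵃ[ℝ] ℝ) :
    IsSemialgebraic {x | 0 ≤ f x} := by
  convert (isSemialgebraic_affine_pos f).union (isSemialgebraic_affine_zero f) using 1
  ext x
  simp [le_iff_lt_or_eq, eq_comm]

/-- The difference of the last coordinate and an affine function of the others. -/
def lastSub {n : ℕ} (l : (Fin n → ℝ) →ᵃ[ℝ] ℝ) : (Fin (n + 1) → ℝ) →ᵃ[ℝ] ℝ :=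
  (LinearMap.proj (Fin.last n) : (Fin (n + 1) → ℝ) →ₗ[ℝ] ℝ).toAffineMap -
    l.comp (LinearMap.funLeft ℝ ℝ Fin.castSucc).toAffineMap

theorem lastSub_apply {n : ℕ} (l : (Fin n → ℝ) →ᵃ[ℝ] ℝ) (x : Fin (n + 1) → ℝ) :
    lastSub l x = x (Fin.last n) - l (Fin.init x) := rfl

/-- Common to maxima (`σ = 1`) and minima (`σ = -1`) of finitely many affine functions: `t` is the
extremum exactly when it equals one of the values and lies on the correct side of all of them, which
are polynomial conditions. -/
theorem isContSemialg_of_extremum {n : ℕ} {B : Set (Fin n → ℝ)} (hB : IsSemialgebraic B)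
    {f : (Fin n → ℝ) → ℝ} (hf : Continuous f) (L : Finset ((Fin n → ℝ) →ᵃ[ℝ] ℝ)) (σ : ℝ)
    (h : ∀ y t, t = f y ↔ (∃ l ∈ L, t - l y = 0) ∧ ∀ l ∈ L, 0 ≤ σ * (t - l y)) :
    IsContSemialg B f := by
  refine ⟨hf.continuousOn, ?_⟩
  convert hB.preimage_init.inter
    ((IsSemialgebraic.biUnion L fun l _ => isSemialgebraic_affine_zero (lastSub l)).inter
      (IsSemialgebraic.biInter L fun l _ => isSemialgebraic_affine_nonneg (σ • lastSub l))) using 1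
  ext x
  simp [graphOver, h, lastSub_apply]

theorem isContSemialg_sup' {n : ℕ} {B : Set (Fin n → ℝ)} (hB : IsSemialgebraic B)
    {L : Finset ((Fin n → ℝ) →ᵃ[ℝ] ℝ)} (hL : L.Nonempty) :
    IsContSemialg B fun y => L.sup' hL fun l => l y := by
  refine isContSemialg_of_extremum hB (Continuous.finset_sup'_apply hL fun l _ =>
    l.continuous_of_finiteDimensional) L 1 fun y t => ⟨?_, ?_⟩
  · rintro rfl
    obtain ⟨l, hl, h⟩ := L.exists_mem_eq_sup' hL fun l => l y
    exact ⟨⟨l, hl, by rw [h, sub_self]⟩, fun l' hl' => by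
      rw [one_mul, sub_nonneg]; exact Finset.le_sup' (fun l => l y) hl'⟩
  · rintro ⟨⟨l, hl, h⟩, h'⟩
    refine le_antisymm ?_ (Finset.sup'_le _ _ fun l' hl' => by linarith [h' l' hl'])
    rw [sub_eq_zero.1 h]
    exact Finset.le_sup' (fun l => l y) hl

theorem isContSemialg_inf' {n : ℕ} {B : Set (Fin n → ℝ)} (hB : IsSemialgebraic B)
    {L : Finset ((Fin n → ℝ) →ᵃ[ℝ] ℝ)} (hL : L.Nonempty) :
    IsContSemialg B fun y => L.inf' hL fun l => l y := by
  refine isContSemialg_of_extremum hB (Continuous.finset_inf'_apply hL fun l _ =>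
    l.continuous_of_finiteDimensional) L (-1) fun y t => ⟨?_, ?_⟩
  · rintro rfl
    obtain ⟨l, hl, h⟩ := L.exists_mem_eq_inf' hL fun l => l y
    exact ⟨⟨l, hl, by rw [h, sub_self]⟩, fun l' hl' => by
      have := Finset.inf'_le (fun l => l y) hl'
      linarith⟩
  · rintro ⟨⟨l, hl, h⟩, h'⟩
    refine le_antisymm (Finset.le_inf' _ _ fun l' hl' => by linarith [h' l' hl']) ?_
    rw [sub_eq_zero.1 h]
    exact Finset.inf'_le (fun l => l y) hl

theorem isContSemialg_affine {n : ℕ} {B : Set (Fin n → ℝ)} (hB : IsSemialgebraic B)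
    (l : (Fin n → ℝ) →ᵃ[ℝ] ℝ) : IsContSemialg B l := by
  simpa using isContSemialg_sup' hB (Finset.singleton_nonempty l)

/-! ### Relatively open polyhedra are cells -/

/-- The relatively open polyhedron where the functions in `E` vanish and those in `G` are
positive. -/
def openPolyhedron {n : ℕ} (E G : Finset ((Fin n → ℝ) →ᵃ[ℝ] ℝ)) : Set (Fin n → ℝ) :=
  {x | (∀ e ∈ E, e x = 0) ∧ ∀ g ∈ G, 0 < g x}

theorem isSemialgebraic_openPolyhedron {n : ℕ} (E G : Finset ((Fin n → ℝ) →ᵃ[ℝ] ℝ)) :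
    IsSemialgebraic (openPolyhedron E G) := by
  convert (IsSemialgebraic.biInter E fun e _ => isSemialgebraic_affine_zero e).inter
    (IsSemialgebraic.biInter G fun g _ => isSemialgebraic_affine_pos g) using 1
  ext x
  simp [openPolyhedron]

/-- The graph embedding `y ↦ (y, l y)` of an affine function `l`. -/
def snocAffine {n : ℕ} (l : (Fin n → ℝ) →ᵃ[ℝ] ℝ) : (Fin n → ℝ) →ᵃ[ℝ] (Fin (n + 1) → ℝ) :=
  AffineMap.pi (Fin.snoc (α := fun _ => (Fin n → ℝ) →ᵃ[ℝ] ℝ)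
    (fun i => (LinearMap.proj i : (Fin n → ℝ) →ₗ[ℝ] ℝ).toAffineMap) l)

theorem snocAffine_apply {n : ℕ} (l : (Fin n → ℝ) →ᵃ[ℝ] ℝ) (y : Fin n → ℝ) :
    snocAffine l y = (Fin.snoc y (l y) : Fin (n + 1) → ℝ) := by
  ext i
  refine Fin.lastCases ?_ (fun i => ?_) i <;> simp [snocAffine]

/-- The coefficient of the last coordinate in an affine function. -/
def lastSlope {n : ℕ} (f : (Fin (n + 1) → ℝ) →ᵃ[ℝ] ℝ) : ℝ :=
  f.linear (Pi.single (Fin.last n) 1)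

/-- The restriction of an affine function to the hyperplane where the last coordinate vanishes. -/
def restrictInit {n : ℕ} (f : (Fin (n + 1) → ℝ) →ᵃ[ℝ] ℝ) : (Fin n → ℝ) →ᵃ[ℝ] ℝ :=
  f.comp (snocAffine 0)

theorem apply_eq_restrictInit_add {n : ℕ} (f : (Fin (n + 1) → ℝ) →ᵃ[ℝ] ℝ) (x : Fin (n + 1) → ℝ) :
    f x = restrictInit f (Fin.init x) + x (Fin.last n) * lastSlope f := by
  have h : x = x (Fin.last n) • Pi.single (Fin.last n) (1 : ℝ) +ᵥ
      (Fin.snoc (Fin.init x) 0 : Fin (n + 1) → ℝ) := by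
    ext i
    refine Fin.lastCases ?_ (fun i => ?_) i <;> simp [Fin.init]
  conv_lhs => rw [h, AffineMap.map_vadd]
  simp [restrictInit, snocAffine_apply, lastSlope, add_comm]

/-- The affine function whose graph is the zero set of `f`, if `lastSlope f ≠ 0`. -/
noncomputable def solveLast {n : ℕ} (f : (Fin (n + 1) → ℝ) →ᵃ[ℝ] ℝ) : (Fin n → ℝ) →ᵃ[ℝ] ℝ :=
  (-(lastSlope f)⁻¹) • restrictInit f

theorem apply_eq_mul_sub_solveLast {n : ℕ} {f : (Fin (n + 1) → ℝ) →ᵃ[ℝ] ℝ} (hf : lastSlope f ≠ 0)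
    (x : Fin (n + 1) → ℝ) :
    f x = lastSlope f * (x (Fin.last n) - solveLast f (Fin.init x)) := by
  rw [apply_eq_restrictInit_add]
  simp only [solveLast, AffineMap.coe_smul, Pi.smul_apply, smul_eq_mul]
  field_simp
  ring

open Classical in
/-- A relatively open polyhedron projects to a relatively open polyhedron; it is a cell if its
projection is one. -/
theorem exists_image_init_openPolyhedron {n : ℕ} (E G : Finset ((Fin (n + 1) → ℝ) →ᵃ[ℝ] ℝ)) :
    ∃ E' G' : Finset ((Fin n → ℝ) →ᵃ[ℝ] ℝ),
      (Fin.init : (Fin (n + 1) → ℝ) → Fin n → ℝ) '' openPolyhedron E G = openPolyhedron E' G' ∧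
      ∀ d, IsCell n d (openPolyhedron E' G') → ∃ d', IsCell (n + 1) d' (openPolyhedron E G) := by
  -- If an equation involves the last coordinate, it can be solved for it. The polyhedron is then a
  -- graph, and substitution into the other constraints describes its base.
  by_cases hE : ∃ e ∈ E, lastSlope e ≠ 0
  · obtain ⟨e, he, hs⟩ := hE
    set l := solveLast e
    set E' := E.image fun f => f.comp (snocAffine l)
    set G' := G.image fun f => f.comp (snocAffine l)
    have hC : openPolyhedron E G = graphOver (openPolyhedron E' G') l := by
      ext x
      have hx : x (Fin.last n) = l (Fin.init x) → snocAffine l (Fin.init x) = x := fun h => by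
        rw [snocAffine_apply, ← h, Fin.snoc_init_self]
      have h0 : e x = 0 → x (Fin.last n) = l (Fin.init x) := fun h => by
        rw [apply_eq_mul_sub_solveLast hs] at h
        exact sub_eq_zero.1 ((mul_eq_zero.1 h).resolve_left hs)
      constructor
      · rintro ⟨h1, h2⟩
        have h := h0 (h1 e he)
        refine ⟨⟨?_, ?_⟩, h⟩
        · simpa [E', hx h] using h1
        · simpa [G', hx h] using h2
      · rintro ⟨⟨h1, h2⟩, h⟩
        refine ⟨?_, ?_⟩
        · simpa [E', hx h] using h1
        · simpa [G', hx h] using h2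
    refine ⟨E', G', ?_, fun d hd => ⟨d, ?_⟩⟩
    · rw [hC]
      ext y
      constructor
      · rintro ⟨x, hx, rfl⟩
        exact hx.1
      · intro hy
        exact ⟨Fin.snoc y (l y), by simp [graphOver, hy], by simp⟩
    · rw [hC]
      exact .graph hd (isContSemialg_affine (isSemialgebraic_openPolyhedron _ _) l)
  -- Fourier–Motzkin elimination: each strict inequality either does not involve the last coordinate
  -- or bounds it from one side, from below for positive slope and from above for negative slope.
  · push Not at hE
    set Lo := (G.filter fun g => 0 < lastSlope g).image solveLast with hLo
    set Up := (G.filter fun g => lastSlope g < 0).image solveLast with hUp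
    set E' := E.image restrictInit with hE'
    -- A last coordinate compatible with all bounds exists exactly when every lower bound is below
    -- every upper bound, whence the pairwise differences.
    set G' := (G.filter fun g => lastSlope g = 0).image restrictInit ∪
      (Lo ×ˢ Up).image fun p => p.2 - p.1 with hG'
    have hB : ∀ y, y ∈ openPolyhedron E' G' ↔ (∀ e ∈ E, restrictInit e y = 0) ∧
        (∀ g ∈ G, lastSlope g = 0 → 0 < restrictInit g y) ∧ ∀ l ∈ Lo, ∀ u ∈ Up, l y < u y := by
      intro y
      simp only [openPolyhedron, mem_ofPred_eq, hE', hG', Finset.forall_mem_image,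
        Finset.mem_union, or_imp, forall_and, Finset.mem_filter, Finset.mem_product, and_imp,
        Prod.forall, AffineMap.coe_sub, Pi.sub_apply, sub_pos]
      refine and_congr_right fun _ => and_congr_right fun _ => ?_
      exact ⟨fun h l hl u hu => h l u hl hu, fun h l u hl hu => h l hl u hu⟩
    have hC : ∀ x, x ∈ openPolyhedron E G ↔ (∀ e ∈ E, restrictInit e (Fin.init x) = 0) ∧
        (∀ g ∈ G, lastSlope g = 0 → 0 < restrictInit g (Fin.init x)) ∧
        (∀ l ∈ Lo, l (Fin.init x) < x (Fin.last n)) ∧ ∀ u ∈ Up, x (Fin.last n) < u (Fin.init x) := by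
      intro x
      have h1 : (∀ e ∈ E, e x = 0) ↔ ∀ e ∈ E, restrictInit e (Fin.init x) = 0 :=
        forall₂_congr fun e he => by rw [apply_eq_restrictInit_add, hE e he, mul_zero, add_zero]
      simp only [openPolyhedron, mem_ofPred_eq, h1, hLo, hUp, Finset.forall_mem_image,
        Finset.mem_filter, and_imp]
      refine and_congr_right fun _ => ?_
      rw [← forall₂_and, ← forall₂_and]
      refine forall₂_congr fun g hg => ?_
      rcases lt_trichotomy (lastSlope g) 0 with h | h | h
      · rw [apply_eq_mul_sub_solveLast h.ne, mul_pos_iff]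
        simp [h, h.ne, h.not_gt]
      · rw [apply_eq_restrictInit_add]
        simp [h]
      · rw [apply_eq_mul_sub_solveLast h.ne', mul_pos_iff]
        simp [h, h.ne', h.not_gt]
    have hCB : ∀ x, x ∈ openPolyhedron E G ↔ Fin.init x ∈ openPolyhedron E' G' ∧
        (∀ l ∈ Lo, l (Fin.init x) < x (Fin.last n)) ∧
        ∀ u ∈ Up, x (Fin.last n) < u (Fin.init x) := by
      intro x
      rw [hC, hB]
      constructor
      · rintro ⟨h1, h2, h3, h4⟩
        exact ⟨⟨h1, h2, fun l hl u hu => (h3 l hl).trans (h4 u hu)⟩, h3, h4⟩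
      · rintro ⟨⟨h1, h2, -⟩, h3, h4⟩
        exact ⟨h1, h2, h3, h4⟩
    refine ⟨E', G', ?_, fun d hd => ⟨d + 1, ?_⟩⟩
    · ext y
      constructor
      · rintro ⟨x, hx, rfl⟩
        exact ((hCB x).1 hx).1
      · intro hy
        obtain ⟨t, ht1, ht2⟩ : ∃ t, (∀ l ∈ Lo, l y < t) ∧ ∀ u ∈ Up, t < u y := by
          have := Finset.exists_between' (Lo.image fun l => l y) (Up.image fun l => l y) (by
            simpa only [Finset.forall_mem_image] using ((hB y).1 hy).2.2)
          simpa only [Finset.forall_mem_image] using this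
        exact ⟨Fin.snoc y t, (hCB _).2 (by simpa using ⟨hy, ht1, ht2⟩), by simp⟩
    · have hs := isSemialgebraic_openPolyhedron E' G'
      -- The fibre lies strictly between the maximum of `Lo` and the minimum of `Up`; an empty
      -- family stands for an infinite end.
      rcases Lo.eq_empty_or_nonempty with h1 | h1 <;> rcases Up.eq_empty_or_nonempty with h2 | h2
      · convert IsCell.cylinder hd using 1
        ext x
        simp [hCB, h1, h2]
      · convert IsCell.bandBelow hd (isContSemialg_inf' hs h2) using 1
        ext x
        simp only [hCB, h1, mem_ofPred_eq, Finset.lt_inf'_iff]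
        simp
      · convert IsCell.bandAbove hd (isContSemialg_sup' hs h1) using 1
        ext x
        simp only [hCB, h2, mem_ofPred_eq, Finset.sup'_lt_iff]
        simp
      · convert IsCell.band hd (isContSemialg_sup' hs h1) (isContSemialg_inf' hs h2) ?_ using 1
        · ext x
          simp only [hCB, mem_ofPred_eq, Finset.sup'_lt_iff, Finset.lt_inf'_iff]
        · intro y hy
          simpa only [Finset.sup'_lt_iff, Finset.lt_inf'_iff] using
            fun u hu l hl => ((hB y).1 hy).2.2 l hl u hu

/-- Induction on the dimension along the projection. Nonemptiness is essential: the only cell of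
`ℝ⁰` is the whole point. -/
theorem exists_isCell_openPolyhedron {n : ℕ} (E G : Finset ((Fin n → ℝ) →ᵃ[ℝ] ℝ))
    (h : (openPolyhedron E G).Nonempty) : ∃ d, IsCell n d (openPolyhedron E G) := by
  induction n with
  | zero =>
    rw [Subsingleton.eq_univ_of_nonempty h]
    exact ⟨0, .point⟩
  | succ n ih =>
    obtain ⟨E', G', h1, h2⟩ := exists_image_init_openPolyhedron E G
    obtain ⟨d, hd⟩ := ih E' G' (h1 ▸ h.image _)
    exact h2 d hd

/-! ### Semilinear sets -/

/-- A subset of `ℝⁿ` is semilinear if membership depends only on the signs of finitely many affine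
functions. -/
def IsSemilinear {n : ℕ} (S : Set (Fin n → ℝ)) : Prop :=
  ∃ L : Finset ((Fin n → ℝ) →ᵃ[ℝ] ℝ),
    ∀ x y, (∀ f ∈ L, SignType.sign (f x) = SignType.sign (f y)) → x ∈ S → y ∈ S

theorem IsSemilinear.inter {n : ℕ} {S T : Set (Fin n → ℝ)} (hS : IsSemilinear S)
    (hT : IsSemilinear T) : IsSemilinear (S ∩ T) := by
  classical
  obtain ⟨L, hL⟩ := hS
  obtain ⟨M, hM⟩ := hT
  exact ⟨L ∪ M, fun x y h hx => ⟨hL x y (fun f hf => h f (Finset.mem_union_left _ hf)) hx.1,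
    hM x y (fun f hf => h f (Finset.mem_union_right _ hf)) hx.2⟩⟩

theorem IsSemilinear.iUnion {n : ℕ} {ι : Type*} [Fintype ι] {S : ι → Set (Fin n → ℝ)}
    (hS : ∀ i, IsSemilinear (S i)) : IsSemilinear (⋃ i, S i) := by
  classical
  choose L hL using hS
  refine ⟨Finset.univ.biUnion L, fun x y h hx => ?_⟩
  obtain ⟨i, hi⟩ := mem_iUnion.1 hx
  exact mem_iUnion.2 ⟨i, hL i x y (fun f hf => h f (by simpa using ⟨i, hf⟩)) hi⟩

theorem IsSemilinear.preimage {n k : ℕ} {S : Set (Fin n → ℝ)} (hS : IsSemilinear S)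
    (e : (Fin k → ℝ) →ᵃ[ℝ] (Fin n → ℝ)) : IsSemilinear (e ⁻¹' S) := by
  classical
  obtain ⟨L, hL⟩ := hS
  refine ⟨L.image fun f => f.comp e, fun x y h hx => hL (e x) (e y) (fun f hf => ?_) hx⟩
  exact h _ (Finset.mem_image_of_mem _ hf)

theorem isSemilinear_openPolyhedron {n : ℕ} (E G : Finset ((Fin n → ℝ) →ᵃ[ℝ] ℝ)) :
    IsSemilinear (openPolyhedron E G) := by
  classical
  refine ⟨E ∪ G, fun x y h hx => ⟨fun e he => ?_, fun g hg => ?_⟩⟩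
  · have := h e (Finset.mem_union_left _ he)
    rwa [hx.1 e he, sign_zero, eq_comm, sign_eq_zero_iff] at this
  · have := h g (Finset.mem_union_right _ hg)
    rwa [sign_pos (hx.2 g hg), eq_comm, sign_eq_one_iff] at this

theorem isSemilinear_nonneg {n : ℕ} (f : (Fin n → ℝ) →ᵃ[ℝ] ℝ) : IsSemilinear {x | 0 ≤ f x} := by
  refine ⟨{f}, fun x y h hx => ?_⟩
  have h := h f (by simp)
  have hx : 0 ≤ f x := hx
  change 0 ≤ f y
  rwa [← sign_nonneg_iff, ← h, sign_nonneg_iff]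

theorem exists_openPolyhedron_eq_sign {n : ℕ} (L : Finset ((Fin n → ℝ) →ᵃ[ℝ] ℝ))
    (σ : L → SignType) :
    ∃ E G, {x | ∀ f : L, SignType.sign (f.1 x) = σ f} = openPolyhedron E G := by
  classical
  refine ⟨(Finset.univ.filter fun f => σ f = 0).image Subtype.val,
    (Finset.univ.filter fun f => σ f = 1).image Subtype.val ∪
      (Finset.univ.filter fun f => σ f = -1).image fun f => -f.1, ?_⟩
  ext x
  simp only [openPolyhedron, mem_ofPred_eq, Finset.mem_union, or_imp, forall_and,
    Finset.forall_mem_image, Finset.mem_filter, Finset.mem_univ, true_and]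
  rw [← forall_and, ← forall_and]
  refine forall_congr' fun f => ?_
  rcases SignType.trichotomy (σ f) with h | h | h <;>
    simp [h, sign_eq_zero_iff, sign_eq_one_iff, sign_eq_neg_one_iff]

/-- The pieces are the sign vectors of the defining affine functions. Only those realized by a point
of `S` are kept, which makes every piece nonempty; semilinearity puts the whole piece inside `S`. -/
theorem IsSemilinear.exists_partition {n : ℕ} {S : Set (Fin n → ℝ)} (hS : IsSemilinear S) :
    ∃ (ι : Type) (_ : Fintype ι) (C : ι → Set (Fin n → ℝ)), (∀ i, (C i).Nonempty) ∧
      (∀ i, ∃ E G, C i = openPolyhedron E G) ∧ (∀ i j, i ≠ j → Disjoint (C i) (C j)) ∧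
      ⋃ i, C i = S := by
  classical
  obtain ⟨L, hL⟩ := hS
  refine ⟨{σ : L → SignType // ∃ x ∈ S, ∀ f : L, SignType.sign (f.1 x) = σ f}, inferInstance,
    fun σ => {x | ∀ f : L, SignType.sign (f.1 x) = σ.1 f}, ?_, ?_, ?_, ?_⟩
  · rintro ⟨σ, x, -, hx⟩
    exact ⟨x, hx⟩
  · exact fun σ => exists_openPolyhedron_eq_sign L σ.1
  · intro σ τ h
    refine Set.disjoint_left.2 fun x hx hx' => h (Subtype.ext (funext fun f => ?_))
    exact (hx f).symm.trans (hx' f)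
  · ext x
    simp only [mem_iUnion]
    constructor
    · rintro ⟨⟨σ, y, hy, hy'⟩, hx⟩
      exact hL y x (fun f hf => (hy' ⟨f, hf⟩).trans (hx ⟨f, hf⟩).symm) hy
    · intro hx
      exact ⟨⟨fun f => SignType.sign (f.1 x), x, hx, fun _ => rfl⟩, fun _ => rfl⟩

theorem IsSemilinear.nonempty_cellPartition {n : ℕ} {S : Set (Fin n → ℝ)} (hS : IsSemilinear S) :
    Nonempty (CellPartition S) := by
  obtain ⟨ι, _, C, hne, hC, hd, hU⟩ := hS.exists_partition
  have : ∀ i, ∃ d, IsCell n d (C i) := fun i => by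
    obtain ⟨E, G, h⟩ := hC i
    rw [h]
    exact exists_isCell_openPolyhedron E G (h ▸ hne i)
  choose d hd' using this
  let e := (Fintype.equivFin ι).symm
  exact ⟨⟨Fintype.card ι, C ∘ e, d ∘ e, fun i => hd' _,
    fun i j hij => hd _ _ (e.injective.ne hij), by rw [← hU]; exact e.surjective.iUnion_comp C⟩⟩

theorem IsSemilinear.image_init {n : ℕ} {S : Set (Fin (n + 1) → ℝ)} (hS : IsSemilinear S) :
    IsSemilinear ((Fin.init : (Fin (n + 1) → ℝ) → Fin n → ℝ) '' S) := by
  obtain ⟨ι, _, C, -, hC, -, rfl⟩ := hS.exists_partition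
  rw [image_iUnion]
  refine .iUnion fun i => ?_
  obtain ⟨E, G, h⟩ := hC i
  obtain ⟨E', G', h', -⟩ := exists_image_init_openPolyhedron E G
  rw [h, h']
  exact isSemilinear_openPolyhedron E' G'

/-! ### The Euler characteristic of semilinear sets -/

/-- Full additivity of the Euler characteristic. Each set is cut into cells separately, with no
common refinement, since `IsCell.sum_eq_zero` allows cells to overlap. -/
theorem sum_mul_eulerChar_eq_zero {n : ℕ} {ι : Type} [Fintype ι] {a : ι → ℤ}
    {S : ι → Set (Fin n → ℝ)} (hS : ∀ i, IsSemilinear (S i))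
    (h : ∀ x, ∑ i, a i * (S i).indicator 1 x = 0) : ∑ i, a i * eulerChar (S i) = 0 := by
  let P := fun i => (hS i).nonempty_cellPartition.some
  have := IsCell.sum_eq_zero (ι := Σ i, Fin (P i).card) (a := fun p => a p.1)
    (d := fun p => (P p.1).dim p.2) (C := fun p => (P p.1).cell p.2)
    (fun p => (P p.1).isCell p.2) fun x => by
      simpa only [Fintype.sum_sigma, ← Finset.mul_sum, CellPartition.sum_indicator] using h x
  simpa only [Fintype.sum_sigma, ← Finset.mul_sum, ← CellPartition.euler_eq_sum,
    ← eulerChar_eq] using this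

theorem hasSign_Icc {c e : ℝ} (hce : c ≤ e) : HasSign (Icc c e) 1 := by
  -- The right-hand limits of the indicator of `Icc c e` form the indicator of `Ico c e`; the two
  -- differ only at `e`.
  refine ⟨0, (Ico c e).indicator 1, {e}, fun x => ?_, ?_, fun P hP => ?_⟩
  · rcases lt_or_ge x c with h | h
    · filter_upwards [Ioo_mem_nhdsGT h] with t ht
      simp [indicator, h.not_ge, ht.2.not_ge]
    · rcases lt_or_ge x e with h' | h'
      · filter_upwards [Ioo_mem_nhdsGT h'] with t ht
        simp [indicator, h, h', ht.2.le, h.trans ht.1.le]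
      · filter_upwards [self_mem_nhdsWithin] with t ht
        have : e < t := lt_of_le_of_lt h' ht
        simp [indicator, h'.not_gt, this.not_ge]
  · filter_upwards [Iio_mem_atBot c] with t ht
    simp [indicator, (mem_Iio.1 ht).not_ge]
  · simp only [Finset.singleton_subset_iff] at hP
    have : ∀ x, (Icc c e).indicator (1 : ℝ → ℤ) x - (Ico c e).indicator 1 x =
        if x = e then 1 else 0 := fun x => by
      rcases lt_trichotomy x e with h | h | h
      · simp [indicator, h, h.le, h.ne]
      · simp [indicator, h, hce]
      · simp [indicator, h.not_ge, h.not_gt, h.ne']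
    simp [this, hP]

theorem hasSign_of_isCompact_of_convex {J : Set ℝ} (hc : IsCompact J) (hv : Convex ℝ J)
    (hne : J.Nonempty) : HasSign J 1 := by
  rw [eq_Icc_of_connected_compact ⟨hne, hv.isPreconnected⟩ hc]
  exact hasSign_Icc (csInf_le_csSup hne hc.bddBelow hc.bddAbove)

/-- A possibly empty compact convex polytope in `ℝⁿ`. -/
structure IsPolytope {n : ℕ} (S : Set (Fin n → ℝ)) : Prop where
  isCompact : IsCompact S
  convex : Convex ℝ S
  isSemilinear : IsSemilinear S

theorem IsPolytope.inter {n : ℕ} {S T : Set (Fin n → ℝ)} (hS : IsPolytope S) (hT : IsPolytope T) :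
    IsPolytope (S ∩ T) :=
  ⟨hS.isCompact.inter hT.isCompact, hS.convex.inter hT.convex,
    hS.isSemilinear.inter hT.isSemilinear⟩

theorem IsPolytope.biInter {n : ℕ} {ι : Type*} {s : Finset ι} (hs : s.Nonempty)
    {S : ι → Set (Fin n → ℝ)} (h : ∀ i, IsPolytope (S i)) : IsPolytope (⋂ i ∈ s, S i) := by
  classical
  induction hs using Finset.Nonempty.cons_induction with
  | singleton a => simpa using h a
  | cons a s _ _ ih =>
    rw [Finset.cons_eq_insert, Finset.set_biInter_insert]
    exact (h a).inter ih

theorem IsPolytope.preimage {n : ℕ} {S : Set (Fin n → ℝ)} (hS : IsPolytope S)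
    (e : (Fin n → ℝ) ≃ᵃ[ℝ] (Fin n → ℝ)) : IsPolytope (e ⁻¹' S) := by
  refine ⟨?_, hS.convex.affine_preimage e.toAffineMap, hS.isSemilinear.preimage e.toAffineMap⟩
  rw [← e.image_symm]
  exact hS.isCompact.image e.symm.toAffineMap.continuous_of_finiteDimensional

theorem IsPolytope.image_init {n : ℕ} {S : Set (Fin (n + 1) → ℝ)} (hS : IsPolytope S) :
    IsPolytope ((Fin.init : (Fin (n + 1) → ℝ) → Fin n → ℝ) '' S) :=
  ⟨hS.isCompact.image (continuous_pi fun i => continuous_apply i.castSucc),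
    hS.convex.linear_image (LinearMap.funLeft ℝ ℝ Fin.castSucc), hS.isSemilinear.image_init⟩

/-- A Fubini argument: integrating the indicator of `S` along the last coordinate gives the
indicator of its projection, because each nonempty fibre is a compact interval. -/
theorem IsPolytope.eulerChar_image_init {n : ℕ} {S : Set (Fin (n + 1) → ℝ)} (hS : IsPolytope S) :
    eulerChar ((Fin.init : (Fin (n + 1) → ℝ) → Fin n → ℝ) '' S) = eulerChar S := by
  obtain ⟨P⟩ := hS.isSemilinear.nonempty_cellPartition
  obtain ⟨Q⟩ := hS.image_init.isSemilinear.nonempty_cellPartition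
  choose B d ε hB hd hs using fun i => (P.isCell i).exists_base
  set T := (Fin.init : (Fin (n + 1) → ℝ) → Fin n → ℝ) '' S
  have hfib : ∀ y, HasSign {t | (Fin.snoc y t : Fin (n + 1) → ℝ) ∈ S} (T.indicator 1 y) := by
    intro y
    have hl : (fun t => (Fin.snoc y t : Fin (n + 1) → ℝ)) =
        AffineMap.lineMap (Fin.snoc y 0 : Fin (n + 1) → ℝ) (Fin.snoc y 1 : Fin (n + 1) → ℝ) := by
      ext t i
      refine Fin.lastCases ?_ (fun i => ?_) i <;> simp [AffineMap.lineMap_apply]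
    by_cases hy : y ∈ T
    · rw [indicator_of_mem hy]
      refine hasSign_of_isCompact_of_convex ?_ ?_ ?_
      · refine (hS.isCompact.image (continuous_apply (Fin.last n))).of_isClosed_subset ?_ ?_
        · exact hS.isCompact.isClosed.preimage (continuous_const.finSnoc continuous_id)
        · exact fun t ht => ⟨_, ht, by simp⟩
      · have := hS.convex.affine_preimage
          (AffineMap.lineMap (k := ℝ) (Fin.snoc y 0 : Fin (n + 1) → ℝ) (Fin.snoc y 1))
        rwa [← hl] at this
      · obtain ⟨x, hx, rfl⟩ := hy
        exact ⟨x (Fin.last n), by simpa using hx⟩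
    · rw [indicator_of_notMem hy]
      convert hasSign_empty
      refine eq_empty_of_forall_notMem fun t ht => hy ⟨_, ht, by simp⟩
  -- Over each `y` the cells of `P` partition the fibre of `S`, so their signs add up to that of the
  -- fibre. The extra index in `Unit` carries the fibre with coefficient `-1`.
  have hbase : ∀ y, ∑ i, ε i * (B i).indicator 1 y = T.indicator 1 y := by
    intro y
    have := HasSign.sum_eq_zero (ι := Fin P.card ⊕ Unit)
      (a := Sum.elim (fun _ => 1) fun _ => -1)
      (J := Sum.elim (fun i => {t | (Fin.snoc y t : Fin (n + 1) → ℝ) ∈ P.cell i})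
        fun _ => {t | (Fin.snoc y t : Fin (n + 1) → ℝ) ∈ S})
      (ε := Sum.elim (fun i => ε i * (B i).indicator 1 y) fun _ => T.indicator 1 y)
      (by rintro (i | i); exacts [hs i y, hfib y]) fun t => by
        have h := P.sum_indicator (Fin.snoc y t)
        rw [Fintype.sum_sum_type]
        simp only [Sum.elim_inl, Sum.elim_inr, one_mul, Fintype.sum_unique, neg_mul,
          add_neg_eq_zero]
        exact h
    simpa [add_neg_eq_zero] using this
  -- The bases `B i`, weighted by `ε i`, and the cells of `Q` have the same sum of indicators. Hence
  -- their alternating sums agree, and by `hd` the former is that of `P`.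
  have := IsCell.sum_eq_zero (ι := Fin P.card ⊕ Fin Q.card) (a := Sum.elim ε fun _ => -1)
    (d := Sum.elim d Q.dim) (C := Sum.elim B Q.cell)
    (by rintro (i | i); exacts [hB i, Q.isCell i]) fun y => by
      simp [hbase, Q.sum_indicator]
  simp only [Fintype.sum_sum_type, Sum.elim_inl, Sum.elim_inr, neg_mul, one_mul,
    Finset.sum_neg_distrib, ← hd] at this
  rw [eulerChar_eq P, eulerChar_eq Q, P.euler_eq_sum, Q.euler_eq_sum]
  linarith

theorem IsPolytope.eulerChar_eq_one {n : ℕ} {S : Set (Fin n → ℝ)} (hS : IsPolytope S)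
    (hne : S.Nonempty) : eulerChar S = 1 := by
  induction n with
  | zero =>
    rw [Subsingleton.eq_univ_of_nonempty hne,
      eulerChar_eq ⟨1, fun _ => univ, fun _ => 0, fun _ => .point,
        fun i j h => (h (Subsingleton.elim i j)).elim, by simp [iUnion_const]⟩,
      CellPartition.euler_eq_sum]
    exact Fin.sum_univ_one _
  | succ n ih => rw [← hS.eulerChar_image_init, ih hS.image_init (hne.image _)]

theorem IsPolytope.eulerChar_preimage {n : ℕ} {S : Set (Fin n → ℝ)} (hS : IsPolytope S)
    (e : (Fin n → ℝ) ≃ᵃ[ℝ] (Fin n → ℝ)) : eulerChar (e ⁻¹' S) = eulerChar S := by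
  rcases S.eq_empty_or_nonempty with rfl | h
  · rw [preimage_empty]
  · rw [hS.eulerChar_eq_one h, (hS.preimage e).eulerChar_eq_one (h.preimage e.surjective)]

/-- Inclusion-exclusion for indicators, transported by additivity. In the proof, `none` stands for
the union, with coefficient `-1`, and `some t` for an intersection. -/
theorem eulerChar_iUnion_eq_sum {n : ℕ} {ι : Type} [Fintype ι] {S : ι → Set (Fin n → ℝ)}
    (hS : ∀ i, IsPolytope (S i)) :
    eulerChar (⋃ i, S i) = ∑ t : {t : Finset ι // t.Nonempty},
      (-1) ^ (t.1.card + 1) * eulerChar (⋂ i ∈ t.1, S i) := by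
  classical
  have := sum_mul_eulerChar_eq_zero (ι := Option {t : Finset ι // t.Nonempty})
    (a := fun o => o.elim (-1) fun t => (-1) ^ (t.1.card + 1))
    (S := fun o => o.elim (⋃ i, S i) fun t => ⋂ i ∈ t.1, S i)
    (by
      rintro (_ | t)
      exacts [.iUnion fun i => (hS i).isSemilinear, (IsPolytope.biInter t.2 hS).isSemilinear])
    fun x => by
      have h := Finset.indicator_biUnion_eq_sum_powerset Finset.univ S (1 : (Fin n → ℝ) → ℤ) x
      simp only [Finset.mem_univ, iUnion_true, Finset.powerset_univ, smul_eq_mul] at h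
      rw [Finset.sum_subtype (F := inferInstance) _ (p := Finset.Nonempty) (by simp)] at h
      simp [Fintype.sum_option, h]
  simp only [Fintype.sum_option, Option.elim] at this
  linarith

theorem eulerChar_preimage_iUnion {n : ℕ} {ι : Type} [Fintype ι] {S : ι → Set (Fin n → ℝ)}
    (hS : ∀ i, IsPolytope (S i)) (e : (Fin n → ℝ) ≃ᵃ[ℝ] (Fin n → ℝ)) :
    eulerChar (e ⁻¹' ⋃ i, S i) = eulerChar (⋃ i, S i) := by
  rw [preimage_iUnion, eulerChar_iUnion_eq_sum hS,
    eulerChar_iUnion_eq_sum fun i => (hS i).preimage e]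
  refine Finset.sum_congr rfl fun t _ => ?_
  rw [← (IsPolytope.biInter t.2 hS).eulerChar_preimage e, preimage_iInter₂]

/-! ### Invariance of the Euler curve -/

/-- Extending the vertices to an affine basis of the whole space makes membership in a simplex of
any dimension depend only on the signs of barycentric coordinates; this is what makes simplices
semilinear. -/
theorem convexHull_eq_coord_nonneg {E : Type*} [AddCommGroup E] [Module ℝ E] {t : Set E}
    (b : AffineBasis t ℝ E) (hb : ⇑b = ((↑) : t → E)) [Fintype t] {s : Set E} (hs : s ⊆ t) :
    convexHull ℝ s = {x | ∀ i : t, 0 ≤ b.coord i x ∧ (i.1 ∉ s → b.coord i x = 0)} := by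
  classical
  refine (convexHull_min (fun x hx i => ?_) ?_).antisymm fun x hx => ?_
  · have h : x = b ⟨x, hs hx⟩ := by rw [hb]
    rw [h, b.coord_apply]
    split_ifs with hi
    · exact ⟨zero_le_one, fun h' => (h' (by rw [hi]; exact hx)).elim⟩
    · exact ⟨le_rfl, fun _ => rfl⟩
  · intro x hx y hy p q hp hq hpq i
    have h : b.coord i (p • x + q • y) = p * b.coord i x + q * b.coord i y := by
      simpa using Convex.combo_affine_apply (f := b.coord i) hpq
    rw [h]
    refine ⟨add_nonneg (mul_nonneg hp (hx i).1) (mul_nonneg hq (hy i).1), fun hi => ?_⟩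
    rw [(hx i).2 hi, (hy i).2 hi, mul_zero, mul_zero, add_zero]
  · have h1 := b.sum_coord_apply_eq_one x
    have h2 := b.linear_combination_coord_eq_self x
    rw [← Finset.sum_filter_of_ne (p := fun i : t => i.1 ∈ s)
      fun i _ h => by_contra fun hi => h ((hx i).2 hi)] at h1
    rw [← Finset.sum_filter_of_ne (p := fun i : t => i.1 ∈ s)
      fun i _ h => by_contra fun hi => h (by rw [(hx i).2 hi, zero_smul])] at h2
    rw [← h2]
    refine (convex_convexHull ℝ s).sum_mem (fun i _ => (hx i).1) h1 fun i hi => ?_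
    rw [hb]
    exact subset_convexHull ℝ s (Finset.mem_filter.1 hi).2

theorem isPolytope_convexHull {n : ℕ} {s : Finset (EuclideanSpace ℝ (Fin n))}
    (hs : AffineIndependent ℝ ((↑) : s → EuclideanSpace ℝ (Fin n))) :
    IsPolytope {x : Fin n → ℝ |
      WithLp.toLp 2 x ∈ convexHull ℝ (s : Set (EuclideanSpace ℝ (Fin n)))} := by
  classical
  refine ⟨?_, ?_, ?_⟩
  · have := s.finite_toSet.isCompact_convexHull (𝕜 := ℝ)
    convert this.image (PiLp.continuous_ofLp 2 fun _ : Fin n => ℝ) using 1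
    ext x
    constructor
    · exact fun hx => ⟨_, hx, rfl⟩
    · rintro ⟨y, hy, rfl⟩
      exact hy
  · exact (convex_convexHull ℝ (s : Set (EuclideanSpace ℝ (Fin n)))).linear_preimage
      (WithLp.linearEquiv 2 ℝ (Fin n → ℝ)).symm.toLinearMap
  · obtain ⟨t, hst, ht, htop⟩ := exists_subset_affineIndependent_affineSpan_eq_top
      (s := (s : Set (EuclideanSpace ℝ (Fin n)))) hs
    let b : AffineBasis t ℝ (EuclideanSpace ℝ (Fin n)) :=
      ⟨(↑), ht, by rw [Subtype.range_coe, htop]⟩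
    have : Fintype t := (b.finite_set).fintype
    rw [convexHull_eq_coord_nonneg b rfl hst]
    refine ⟨Finset.univ.image fun i : t =>
      (b.coord i).comp (WithLp.linearEquiv 2 ℝ (Fin n → ℝ)).symm.toLinearMap.toAffineMap,
      fun x y h hx i => ?_⟩
    have h : SignType.sign (b.coord i (WithLp.toLp 2 x)) =
      SignType.sign (b.coord i (WithLp.toLp 2 y)) := h _ (Finset.mem_image_of_mem _ (by simp))
    refine ⟨?_, fun hi => ?_⟩
    · rw [← sign_nonneg_iff, ← h, sign_nonneg_iff]
      exact (hx i).1
    · rw [← sign_eq_zero_iff, ← h, sign_eq_zero_iff]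
      exact (hx i).2 hi

theorem IsPolytope.inter_halfspace {n : ℕ} {S : Set (Fin n → ℝ)} (hS : IsPolytope S)
    (v : EuclideanSpace ℝ (Fin n)) (r : ℝ) :
    IsPolytope (S ∩ {x | inner ℝ (WithLp.toLp 2 x) v ≤ r}) := by
  let f : (Fin n → ℝ) →ᵃ[ℝ] ℝ := AffineMap.const ℝ _ r - ((innerₛₗ ℝ v).comp
    (WithLp.linearEquiv 2 ℝ (Fin n → ℝ)).symm.toLinearMap).toAffineMap
  have h : {x | inner ℝ (WithLp.toLp 2 x) v ≤ r} = {x | 0 ≤ f x} := by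
    ext x
    simp [f, real_inner_comm]
  rw [h]
  exact ⟨hS.isCompact.inter_right (isClosed_le continuous_const
    f.continuous_of_finiteDimensional), hS.convex.inter ((convex_Ici 0).affine_preimage f),
    hS.isSemilinear.inter (isSemilinear_nonneg f)⟩

namespace EmbeddedComplex

/-- The geometric input to both the rotation and the translation statement: a sublevel set may be
replaced by its preimage under any affine automorphism. -/
theorem eulerChar_preimage_sublevel {n : ℕ} (K : EmbeddedComplex n) (v : UnitSphere n) (r : ℝ)
    (e : EuclideanSpace ℝ (Fin n) ≃ᵃ[ℝ] EuclideanSpace ℝ (Fin n)) :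
    (eulerChar {x : Fin n → ℝ | e (WithLp.toLp 2 x) ∈ K.sublevel v r} : ℝ) =
      K.eulerCurve v r := by
  have : Fintype K.faces := K.finite_faces.fintype
  have h : {x : Fin n → ℝ | WithLp.toLp 2 x ∈ K.sublevel v r} = ⋃ s : K.faces,
      {x : Fin n → ℝ | WithLp.toLp 2 x ∈
        convexHull ℝ (s.1 : Set (EuclideanSpace ℝ (Fin n)))} ∩
      {x | inner ℝ (WithLp.toLp 2 x) (v : EuclideanSpace ℝ (Fin n)) ≤ r} := by
    ext x
    simp [sublevel, Geometry.SimplicialComplex.space, and_comm]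
  let a := (WithLp.linearEquiv 2 ℝ (Fin n → ℝ)).symm.toAffineEquiv
  have := eulerChar_preimage_iUnion
    (fun s : K.faces => (isPolytope_convexHull (K.indep s.2)).inter_halfspace v r)
    ((a.trans e).trans a.symm)
  rw [← h] at this
  exact congrArg _ this

theorem eulerCurve_rotate {n : ℕ} (K : EmbeddedComplex n) (R : Matrix.orthogonalGroup (Fin n) ℝ)
    (v : UnitSphere n) : (K.rotate R).eulerCurve v = rotateFun R K.eulerCurve v := by
  have h1 : ∀ x, orthogonalMap R (orthogonalMap R⁻¹ x) = x := fun x => by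
    simp [orthogonalMap_apply]
  have h2 : ∀ x, orthogonalMap R⁻¹ (orthogonalMap R x) = x := fun x => by
    simp [orthogonalMap_apply]
  funext r
  rw [rotateFun, ← eulerChar_preimage_sublevel K _ r (orthogonalMap R).toLinearEquiv.toAffineEquiv]
  refine congrArg (fun S => (eulerChar S : ℝ)) (Set.ext fun x => ?_)
  refine and_congr ?_ ?_
  -- Orthogonality, $Rx\cdot Rv = x\cdot v$, matches the half-space for $v$ with the one for $Rv$.
  · exact (congrArg (· ≤ r) ((orthogonalMap R).inner_map_map (WithLp.toLp 2 x) v)).symm.to_iff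
  · rw [space_rotate]
    constructor
    · rintro ⟨y, hy, h⟩
      change orthogonalMap R (WithLp.toLp 2 x) ∈ K.space
      rwa [← h, h1]
    · exact fun hx => ⟨_, hx, h2 _⟩

theorem eulerCurve_translate {n : ℕ} (K : EmbeddedComplex n) (w : EuclideanSpace ℝ (Fin n))
    (v : UnitSphere n) (r : ℝ) : (K.translate w).eulerCurve v r =
      K.eulerCurve v (r + -inner ℝ w (v : EuclideanSpace ℝ (Fin n))) := by
  -- A point $x$ lies in $(K+w)_{v,r}$ exactly when $x-w$ lies in $K_{v,r-w\cdot v}$.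
  rw [← eulerChar_preimage_sublevel K v _ (AffineEquiv.constVAdd ℝ _ (-w))]
  refine congrArg (fun S => (eulerChar S : ℝ)) (Set.ext fun x => ?_)
  refine and_congr ?_ ?_
  · simp [inner_add_left, add_comm]
  · simp [space_translate, add_comm]

theorem eulerCurve_congr {n : ℕ} {K K' : EmbeddedComplex n} (h : K.space = K'.space)
    (v : UnitSphere n) : K.eulerCurve v = K'.eulerCurve v := by
  funext r
  simp only [eulerCurve, sublevel, h]

theorem IsSubdivision.space_eq {n : ℕ} {K' K : EmbeddedComplex n} (h : K'.IsSubdivision K) :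
    K'.space = K.space := by
  ext x
  simp only [space, Geometry.SimplicialComplex.mem_space_iff]
  constructor
  · rintro ⟨s, hs, hx⟩
    obtain ⟨t, ht, hst⟩ := h.1 s hs
    exact ⟨t, ht, hst hx⟩
  · rintro ⟨t, ht, hx⟩
    obtain ⟨F, -, hF, hU⟩ := h.2 t ht
    rw [hU] at hx
    obtain ⟨s, hs, hx⟩ := mem_iUnion₂.1 hx
    exact ⟨s, hF hs, hx⟩

end EmbeddedComplex

end EulerCurve

theorem mainTheorem1 {n m : ℕ} (D : Fin m → (ℝ → ℝ) → ℝ)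
    (hD : ∀ i, EulerCurve.IsTranslationInvariant (D i)) :
    (∀ (K : EulerCurve.EmbeddedComplex n) (R : Matrix.orthogonalGroup (Fin n) ℝ),
      (K.rotate R).curveFeatures D = EulerCurve.rotateFun R (K.curveFeatures D)) ∧
    (∀ (K : EulerCurve.EmbeddedComplex n) (w : EuclideanSpace ℝ (Fin n)),
      (K.translate w).curveFeatures D = K.curveFeatures D) ∧
    (∀ K K' : EulerCurve.EmbeddedComplex n, K'.IsSubdivision K →
      K'.curveFeatures D = K.curveFeatures D) := by
  refine ⟨fun K R => ?_, fun K w => ?_, fun K K' h => ?_⟩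
  · funext v i
    exact congrArg (D i) (K.eulerCurve_rotate R v)
  · funext v i
    -- The shift is $-w\cdot v$. It may vary with $v$, since invariance is applied to one direction
    -- at a time.
    exact hD i _ _ ⟨_, K.eulerCurve_translate w v⟩
  · funext v i
    exact congrArg (D i) (EulerCurve.EmbeddedComplex.eulerCurve_congr h.space_eq v)
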